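/- Let $n\ge 1$, let $\Sigma$ be a real symmetric positive definite $2\times 2$ matrix, let $\mu_1,\dots,\mu_n\in\mathbb{R}^2$, and let $\xi_1,\dots,\xi_n$ be independent random vectors with $\xi_i\sim\mathcal{N}_2(\mu_i,\Sigma)$. Let $\Xi=(\xi_1,\dots,\xi_n)\in\mathbb{R}^{2\times n}$, let $W=\Xi\Xi^{\top}$ be the corresponding (possibly non-central) real Wishart matrix, with eigenvalues $\lambda_1(W)\ge\lambda_2(W)$, and let $\Omega=\Sigma^{-1}\sum_{i=1}^n\mu_i\mu_i^{\top}$. Suppose that at least one of the matrices $\Sigma$ and $\Sigma\Omega$ has two distinct eigenvalues. Then $$\Pr(\lambda_2(W)\ge x)=o\bigl(\Pr(\lambda_1(W)\ge x)\bigr)\qquad\text{as }x\to\infty .$$ Consequently the alternating sum $\Pr(\lambda_1(W)\ge x)-\Pr(\lambda_2(W)\ge x)$, which is the quantity evaluated by the Euler characteristic method, is asymptotically equivalent to the tail probability $\Pr(\lambda_1(W)\ge x)$ as $x\to\infty$. -/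

import Mathlib

open MeasureTheory ProbabilityTheory Filter Asymptotics

noncomputable section

/-- The matrix `Ξ = (ξ₁, …, ξₙ)` whose columns are the vectors `ξᵢ ∈ ℝᵐ`. -/
def columnMatrix {m n : ℕ} (ξ : Fin n → EuclideanSpace ℝ (Fin m)) :
    Matrix (Fin m) (Fin n) ℝ :=
  Matrix.of fun j i => ξ i j

/-- The matrix `W = Ξ Ξᵀ`. If the `ξᵢ` are independent with law `N(μᵢ, S)`, then `W` is a
(non-central) real Wishart matrix. -/
def wishartMatrix {m n : ℕ} (ξ : Fin n → EuclideanSpace ℝ (Fin m)) :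
    Matrix (Fin m) (Fin m) ℝ :=
  columnMatrix ξ * (columnMatrix ξ).transpose

theorem wishartMatrix_isHermitian {m n : ℕ} (ξ : Fin n → EuclideanSpace ℝ (Fin m)) :
    (wishartMatrix ξ).IsHermitian := by
  simpa [wishartMatrix, Matrix.conjTranspose_eq_transpose_of_trivial] using
    Matrix.isHermitian_mul_conjTranspose_self (columnMatrix ξ)

/-- The eigenvalues `λ₁(W) ≥ λ₂(W) ≥ … ≥ λₘ(W)` of `W = Ξ Ξᵀ`, in decreasing order and with
multiplicity. The indices start at `0`, so that `λ₁(W)` is the value at `0`. -/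
def wishartEigenvalue {m n : ℕ} (ξ : Fin n → EuclideanSpace ℝ (Fin m)) (k : Fin m) : ℝ :=
  (wishartMatrix_isHermitian ξ).eigenvalues₀ (k.cast (Fintype.card_fin m).symm)

/-- The parameter matrix `Ω = S⁻¹ ∑ᵢ μᵢ μᵢᵀ` of the Wishart distribution `W_m(n, S; Ω)`. -/
def noncentralityMatrix {m n : ℕ} (S : Matrix (Fin m) (Fin m) ℝ)
    (μ : Fin n → EuclideanSpace ℝ (Fin m)) : Matrix (Fin m) (Fin m) ℝ :=
  S⁻¹ * ∑ i, Matrix.vecMulVec (μ i) (μ i)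

/-- The `m × m` real matrix `A` has distinct eigenvalues: `m` different real eigenvalues. -/
def HasDistinctEigenvalues {m : ℕ} (A : Matrix (Fin m) (Fin m) ℝ) : Prop :=
  {a : ℝ | Module.End.HasEigenvalue (Matrix.toLin' A) a}.ncard = m

/-- The tail probability `Pr(λₖ(W) ≥ x)`, where `W` is formed from the random vectors `ξᵢ`
(`k` counted from `0`). -/
def eigenvalueTail {𝓧 : Type*} [MeasurableSpace 𝓧] (P : Measure 𝓧) {m n : ℕ}
    (ξ : Fin n → 𝓧 → EuclideanSpace ℝ (Fin m)) (k : Fin m) (x : ℝ) : ℝ :=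
  P.real {ω | x ≤ wishartEigenvalue (fun i => ξ i ω) k}

/-- The alternating sum
`Pr(λ₁(W) ≥ x) - Pr(λ₂(W) ≥ x) + ⋯ + (-1)^(m-1) Pr(λₘ(W) ≥ x)` evaluated by the Euler
characteristic method. -/
def alternatingTailSum {𝓧 : Type*} [MeasurableSpace 𝓧] (P : Measure 𝓧) {m n : ℕ}
    (ξ : Fin n → 𝓧 → EuclideanSpace ℝ (Fin m)) (x : ℝ) : ℝ :=
  ∑ k : Fin m, (-1 : ℝ) ^ (k : ℕ) * eigenvalueTail P ξ k x

end

open scoped InnerProductSpace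

/-! Let `b 0`, `b 1` be orthonormal eigenvectors of `S` and `Q k = ∑ i, ⟪b k, ξ i⟫ ^ 2`, the
quadratic form of `W` at `b k`. By the Rayleigh bounds, `λ₂ ≤ Q k ≤ λ₁` for both `k`. Since `b 0`
and `b 1` are `S`-orthogonal, `Q 0` and `Q 1` are independent
(`indepFun_inner_of_dotProduct_mulVec_eq_zero`). Hence `Pr(λ₂ ≥ x) ≤ Pr(Q 1 ≥ x) Pr(Q 0 ≥ x) ≤ Pr(Q
1 ≥ x) Pr(λ₁ ≥ x)`, and `Pr(Q 1 ≥ x) → 0`. No explicit tail asymptotics are needed. -/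

theorem LinearMap.IsSymmetric.inner_apply_self_eq_sum {E : Type*} [NormedAddCommGroup E]
    [InnerProductSpace ℝ E] [FiniteDimensional ℝ E] {T : E →ₗ[ℝ] E} (hT : T.IsSymmetric) {m : ℕ}
    (hm : Module.finrank ℝ E = m) (u : E) :
    ⟪u, T u⟫_ℝ = ∑ i, hT.eigenvalues hm i * ⟪hT.eigenvectorBasis hm i, u⟫_ℝ ^ 2 := by
  rw [← (hT.eigenvectorBasis hm).sum_inner_mul_inner u (T u)]
  refine Finset.sum_congr rfl fun i _ => ?_
  rw [← hT (hT.eigenvectorBasis hm i) u, hT.apply_eigenvectorBasis, inner_smul_left,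
    real_inner_comm]
  simp
  ring

/-- The quadratic form of the Wishart matrix at `u`. -/
theorem inner_toEuclideanLin_wishartMatrix {m n : ℕ} (ξ : Fin n → EuclideanSpace ℝ (Fin m))
    (u : EuclideanSpace ℝ (Fin m)) :
    ⟪u, Matrix.toEuclideanLin (wishartMatrix ξ) u⟫_ℝ = ∑ i, ⟪u, ξ i⟫_ℝ ^ 2 := by
  have h : ∀ i, ⟪u, ξ i⟫_ℝ = Matrix.vecMul u.ofLp (columnMatrix ξ) i := fun i => by
    simp [PiLp.inner_apply, Matrix.vecMul, dotProduct, columnMatrix, mul_comm]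
  have h' : ⟪u, Matrix.toEuclideanLin (wishartMatrix ξ) u⟫_ℝ =
      u.ofLp ⬝ᵥ (wishartMatrix ξ).mulVec u.ofLp := by
    simp [PiLp.inner_apply, dotProduct, mul_comm, Matrix.toLpLin_apply]
  rw [h', wishartMatrix, ← Matrix.mulVec_mulVec, Matrix.dotProduct_mulVec,
    Matrix.mulVec_transpose]
  simp [dotProduct, h, sq]

/-- For a unit vector, the squared coordinates in an eigenbasis of `W` sum to 1, so the quadratic
form is a weighted mean of the eigenvalues. -/
theorem sum_inner_sq_le_wishartEigenvalue_zero {n : ℕ} (ξ : Fin n → EuclideanSpace ℝ (Fin 2))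
    {u : EuclideanSpace ℝ (Fin 2)} (hu : ‖u‖ = 1) :
    ∑ i, ⟪u, ξ i⟫_ℝ ^ 2 ≤ wishartEigenvalue ξ 0 := by
  have hT := Matrix.isSymmetric_toEuclideanLin_iff.mpr (wishartMatrix_isHermitian ξ)
  rw [← inner_toEuclideanLin_wishartMatrix,
    hT.inner_apply_self_eq_sum (finrank_euclideanSpace (𝕜 := ℝ) (ι := Fin 2))]
  have hsum := (hT.eigenvectorBasis
    (finrank_euclideanSpace (𝕜 := ℝ) (ι := Fin 2))).sum_sq_inner_right u
  calc _ ≤ ∑ i, wishartEigenvalue ξ 0 * ⟪hT.eigenvectorBasis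
        (finrank_euclideanSpace (𝕜 := ℝ) (ι := Fin 2)) i, u⟫_ℝ ^ 2 := by
        refine Finset.sum_le_sum fun i _ => mul_le_mul_of_nonneg_right ?_ (sq_nonneg _)
        exact (wishartMatrix_isHermitian ξ).eigenvalues₀_antitone (Fin.zero_le i)
    _ = _ := by rw [← Finset.mul_sum, hsum, hu]; simp

theorem wishartEigenvalue_one_le_sum_inner_sq {n : ℕ} (ξ : Fin n → EuclideanSpace ℝ (Fin 2))
    {u : EuclideanSpace ℝ (Fin 2)} (hu : ‖u‖ = 1) :
    wishartEigenvalue ξ 1 ≤ ∑ i, ⟪u, ξ i⟫_ℝ ^ 2 := by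
  have hT := Matrix.isSymmetric_toEuclideanLin_iff.mpr (wishartMatrix_isHermitian ξ)
  rw [← inner_toEuclideanLin_wishartMatrix,
    hT.inner_apply_self_eq_sum (finrank_euclideanSpace (𝕜 := ℝ) (ι := Fin 2))]
  have hsum := (hT.eigenvectorBasis
    (finrank_euclideanSpace (𝕜 := ℝ) (ι := Fin 2))).sum_sq_inner_right u
  calc _ = ∑ i, wishartEigenvalue ξ 1 * ⟪hT.eigenvectorBasis
        (finrank_euclideanSpace (𝕜 := ℝ) (ι := Fin 2)) i, u⟫_ℝ ^ 2 := by
        rw [← Finset.mul_sum, hsum, hu]; simp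
    _ ≤ _ := by
        refine Finset.sum_le_sum fun i _ => mul_le_mul_of_nonneg_right ?_ (sq_nonneg _)
        exact (wishartMatrix_isHermitian ξ).eigenvalues₀_antitone (Fin.le_last i)

/-- The coordinates of independent Gaussian vectors along two directions that are orthogonal for
the covariance matrix are independent. -/
theorem indepFun_inner_of_dotProduct_mulVec_eq_zero {𝓧 : Type*} [MeasurableSpace 𝓧]
    {P : Measure 𝓧} {m n : ℕ} {S : Matrix (Fin m) (Fin m) ℝ} (hS : S.PosSemidef)
    {μ : Fin n → EuclideanSpace ℝ (Fin m)} {ξ : Fin n → 𝓧 → EuclideanSpace ℝ (Fin m)}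
    (hlaw : ∀ i, HasLaw (ξ i) (multivariateGaussian (μ i) S) P) (hindep : iIndepFun ξ P)
    {u v : EuclideanSpace ℝ (Fin m)} (huv : u.ofLp ⬝ᵥ S.mulVec v.ofLp = 0) :
    IndepFun (fun ω i => ⟪u, ξ i ω⟫_ℝ) (fun ω i => ⟪v, ξ i ω⟫_ℝ) P := by
  have hG : HasGaussianLaw (fun ω i => ξ i ω) P :=
    hindep.hasGaussianLaw fun i => (hlaw i).hasGaussianLaw
  let L (w : EuclideanSpace ℝ (Fin m)) : (Fin n → EuclideanSpace ℝ (Fin m)) →L[ℝ] (Fin n → ℝ) :=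
    ContinuousLinearMap.pi fun i => (innerSL ℝ w).comp (ContinuousLinearMap.proj i)
  -- Under joint Gaussianity it suffices that all cross-covariances vanish: by `huv` for equal
  -- indices, by independence of the vectors for distinct ones.
  refine HasGaussianLaw.indepFun_of_covariance_eval (hG.map ((L u).prod (L v))) fun i j => ?_
  by_cases hij : i = j
  · subst hij
    have hcov : cov[fun x => ⟪u, x⟫_ℝ, fun x => ⟪v, x⟫_ℝ; multivariateGaussian (μ i) S] = 0 := by
      rw [← covarianceBilin_apply_eq_cov IsGaussian.memLp_two_id,
        covarianceBilin_multivariateGaussian hS, huv]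
    rwa [← (hlaw i).map_eq, covariance_map (by fun_prop) (by fun_prop) (hlaw i).aemeasurable]
      at hcov
  · have hi (w : EuclideanSpace ℝ (Fin m)) (k : Fin n) : MemLp (fun ω => ⟪w, ξ k ω⟫_ℝ) 2 P :=
      ((hlaw k).hasGaussianLaw.map (innerSL ℝ w)).memLp_two
    exact ((hindep.indepFun hij).comp (φ := fun x => ⟪u, x⟫_ℝ) (ψ := fun x => ⟪v, x⟫_ℝ)
      (by fun_prop) (by fun_prop)).covariance_eq_zero (hi u i) (hi v j)

theorem tendsto_measureReal_setOf_le_atTop {𝓧 : Type*} [MeasurableSpace 𝓧] (P : Measure 𝓧)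
    [IsFiniteMeasure P] {f : 𝓧 → ℝ} (hf : AEMeasurable f P) :
    Tendsto (fun x => P.real {ω | x ≤ f ω}) atTop (nhds 0) := by
  have h := tendsto_measure_iInter_atTop (μ := P) (s := fun x : ℝ => {ω | x ≤ f ω})
    (fun x => hf.nullMeasurableSet_preimage measurableSet_Ici)
    (fun x y hxy ω (hω : y ≤ f ω) => le_trans hxy hω) ⟨0, measure_ne_top _ _⟩
  have hempty : ⋂ x : ℝ, {ω | x ≤ f ω} = ∅ := by
    refine Set.eq_empty_of_forall_notMem fun ω hω => ?_
    have : f ω + 1 ≤ f ω := Set.mem_iInter.mp hω (f ω + 1)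
    linarith
  rw [hempty, measure_empty] at h
  exact (ENNReal.tendsto_toReal_zero_iff (fun _ => measure_ne_top _ _)).mpr h

/-- The tail of the smallest eigenvalue of a `2 × 2` Wishart matrix is negligible with respect to
the tail of the largest one. -/
theorem eigenvalueTail_one_isLittleO_eigenvalueTail_zero {𝓧 : Type*} [MeasurableSpace 𝓧]
    (P : Measure 𝓧) [IsProbabilityMeasure P] {n : ℕ} {S : Matrix (Fin 2) (Fin 2) ℝ}
    (hS : S.PosSemidef) {μ : Fin n → EuclideanSpace ℝ (Fin 2)}
    {ξ : Fin n → 𝓧 → EuclideanSpace ℝ (Fin 2)}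
    (hlaw : ∀ i, HasLaw (ξ i) (multivariateGaussian (μ i) S) P) (hindep : iIndepFun ξ P) :
    eigenvalueTail P ξ 1 =o[atTop] eigenvalueTail P ξ 0 := by
  let b := hS.isHermitian.eigenvectorBasis
  let Q (k : Fin 2) (ω : 𝓧) : ℝ := ∑ i, ⟪b k, ξ i ω⟫_ℝ ^ 2
  have hnorm (k : Fin 2) : ‖b k‖ = 1 := b.norm_eq_one k
  -- `S` only rescales `b 1`, so Euclidean orthogonality gives `S`-orthogonality.
  have horth : (b 0).ofLp ⬝ᵥ S.mulVec (b 1).ofLp = 0 := by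
    have h01 : ⟪b 1, b 0⟫_ℝ = 0 := b.orthonormal.2 (by decide)
    rw [EuclideanSpace.inner_eq_star_dotProduct, star_trivial] at h01
    rw [hS.isHermitian.mulVec_eigenvectorBasis, dotProduct_smul, h01, smul_zero]
  have hQ : IndepFun (Q 0) (Q 1) P :=
    (indepFun_inner_of_dotProduct_mulVec_eq_zero hS hlaw hindep horth).comp
      (φ := fun y : Fin n → ℝ => ∑ i, y i ^ 2) (ψ := fun y : Fin n → ℝ => ∑ i, y i ^ 2) (by fun_prop) (by fun_prop)
  have hmeas : AEMeasurable (Q 1) P := by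
    have := fun i => (hlaw i).aemeasurable
    fun_prop
  -- The product form avoids dividing by the tail of `λ₁`, so no positivity of that tail is
  -- required.
  have hbound (x : ℝ) :
      eigenvalueTail P ξ 1 x ≤ P.real {ω | x ≤ Q 1 ω} * eigenvalueTail P ξ 0 x := by
    calc eigenvalueTail P ξ 1 x
        ≤ P.real (Q 0 ⁻¹' Set.Ici x ∩ Q 1 ⁻¹' Set.Ici x) := measureReal_mono fun ω hω =>
          ⟨le_trans hω (wishartEigenvalue_one_le_sum_inner_sq _ (hnorm 0)),
            le_trans hω (wishartEigenvalue_one_le_sum_inner_sq _ (hnorm 1))⟩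
      _ = P.real (Q 1 ⁻¹' Set.Ici x) * P.real (Q 0 ⁻¹' Set.Ici x) := by
          rw [measureReal_def, hQ.measure_inter_preimage_eq_mul _ _ measurableSet_Ici
            measurableSet_Ici, ENNReal.toReal_mul, mul_comm]
          rfl
      _ ≤ _ := mul_le_mul_of_nonneg_left (measureReal_mono fun ω hω =>
          le_trans hω (sum_inner_sq_le_wishartEigenvalue_zero _ (hnorm 0))) measureReal_nonneg
  refine IsLittleO.of_bound fun c hc => ?_
  filter_upwards [(tendsto_measureReal_setOf_le_atTop P hmeas).eventually_le_const hc] with x hx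
  have hnonneg (k : Fin 2) : 0 ≤ eigenvalueTail P ξ k x := measureReal_nonneg
  rw [Real.norm_of_nonneg (hnonneg 1), Real.norm_of_nonneg (hnonneg 0)]
  exact (hbound x).trans (mul_le_mul_of_nonneg_right hx (hnonneg 0))

theorem mainTheorem2 {𝓧 : Type*} [MeasurableSpace 𝓧] (P : Measure 𝓧) [IsProbabilityMeasure P]
    {n : ℕ} (S : Matrix (Fin 2) (Fin 2) ℝ) (hS : S.PosDef)
    (μ : Fin n → EuclideanSpace ℝ (Fin 2))
    (ξ : Fin n → 𝓧 → EuclideanSpace ℝ (Fin 2))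
    (hlaw : ∀ i, HasLaw (ξ i) (multivariateGaussian (μ i) S) P)
    (hindep : iIndepFun ξ P)
    (hdist : HasDistinctEigenvalues S ∨ HasDistinctEigenvalues (S * noncentralityMatrix S μ)) :
    (eigenvalueTail P ξ 1 =o[atTop] eigenvalueTail P ξ 0) ∧
      IsEquivalent atTop (alternatingTailSum P ξ) (eigenvalueTail P ξ 0) := by
  have h := eigenvalueTail_one_isLittleO_eigenvalueTail_zero P hS.posSemidef hlaw hindep
  -- The alternating sum differs from the tail of `λ₁` by exactly minus the tail of `λ₂`.
  refine ⟨h, h.neg_left.congr_left fun x => ?_⟩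
  simp [alternatingTailSum, Fin.sum_univ_two]
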